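/- For positive integers $m,n$ let $[m]^n=\{1,\dots,m\}^n$ be ordered coordinatewise ($x\preceq y$ iff $x_i\le y_i$ for all $i$), and let $S(m,n)$ be the largest cardinality of an antichain of $[m]^n$ (a set of pairwise incomparable elements). Then for every fixed integer $n\ge 2$, as $m\to\infty$, $$S(m,n)=g(n)\,m^{n-1}+O(m^{n-2}),$$ where the implied constant may depend on $n$ and where, with empty sums equal to $0$, $$g(n)=1-2\sum_{j=0}^{\frac{n-4}{2}}\sum_{i=0}^{j}(-1)^i\,\frac{(1+j-i)^{n-1}-(j-i)^{n-1}}{i!\,(n-1-i)!}$$ if $n$ is even, and $$g(n)=1-2\sum_{j=0}^{\frac{n-5}{2}}\sum_{i=0}^{j}(-1)^i\,\frac{(1+j-i)^{n-1}-(j-i)^{n-1}}{i!\,(n-1-i)!}-2\sum_{i=0}^{\frac{n-3}{2}}(-1)^i\,\frac{\left(\frac n2-1-i\right)^{n-1}-\left(\frac{n-3}{2}-i\right)^{n-1}}{i!\,(n-1-i)!}$$ if $n$ is odd. -/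

import Mathlib

open Filter Asymptotics

/-- The ground set `[m]^n = {1, …, m}^n`. It is ordered by the coordinatewise order,
which is the order that `Fin n → ℕ` carries. -/
def gridBox (m n : ℕ) : Finset (Fin n → ℕ) :=
  Fintype.piFinset fun _ => Finset.Icc 1 m

open Classical in
/-- `S(m,n)`: the largest cardinality of a set of pairwise incomparable elements of `[m]^n`.
The supremum is a maximum over a finite family that contains the empty antichain. -/
noncomputable def maxAntichainSize (m n : ℕ) : ℕ :=
  ((gridBox m n).powerset.filter
    fun A : Finset (Fin n → ℕ) => IsAntichain (· ≤ ·) (A : Set (Fin n → ℕ))).sup Finset.card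

/-- The summand `(-1)^i ((b-i)^(n-1) - (a-i)^(n-1)) / (i! (n-1-i)!)`
(only used with `i ≤ n - 1`). -/
noncomputable def antichainTerm (n : ℕ) (a b : ℝ) (i : ℕ) : ℝ :=
  (-1) ^ i * ((b - i) ^ (n - 1) - (a - i) ^ (n - 1)) /
    ((Nat.factorial i : ℝ) * (Nat.factorial (n - 1 - i) : ℝ))

/-- The leading coefficient `g(n)`, for `n ≥ 2`. The index `j` runs over `0, …, (n-4)/2` when `n`
is even and over `0, …, (n-5)/2` when `n` is odd (empty for `n = 2, 3`), the index `i` in the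
double sum over `0, …, j`, and the index `i` in the last sum over `0, …, (n-3)/2`. -/
noncomputable def antichainDensity (n : ℕ) : ℝ :=
  if Even n then
    1 - 2 * ∑ j ∈ Finset.range ((n - 2) / 2), ∑ i ∈ Finset.range (j + 1),
      antichainTerm n j (1 + j) i
  else
    1 - 2 * (∑ j ∈ Finset.range ((n - 3) / 2), ∑ i ∈ Finset.range (j + 1),
        antichainTerm n j (1 + j) i)
      - 2 * (∑ i ∈ Finset.range ((n - 1) / 2),
        antichainTerm n (((n : ℝ) - 3) / 2) ((n : ℝ) / 2 - 1) i)

/-! The box splits into chains symmetric about the middle rank (`exists_symmetric_chain_labelling`).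
Each chain meets the middle layer and an antichain at most once, so that layer is a largest
antichain. Expanding `(X + ⋯ + X ^ m) ^ n` counts the layer as an alternating sum of binomials
(`card_gridLayer`). With `n = k + 1`, each binomial is `(c * m) ^ k / k!` up to `O(m ^ (k - 1))`,
where `c = (k + 1) / 2 - i`. The resulting constant is the probability that a sum of `k` uniform
variables on `[0, 1]` lies within `1 / 2` of its mean. By symmetry this is one minus twice the lower
tail, which is `g(n)` once its double sum telescopes (`sum_alternating_half`). -/

/-! ### Symmetric chains and the middle layer. -/

theorem mem_gridBox {m n : ℕ} {x : Fin n → ℕ} :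
    x ∈ gridBox m n ↔ ∀ i, 1 ≤ x i ∧ x i ≤ m := by
  simp [gridBox]

/-- A symmetric chain decomposition of `[m]^n`: the fibres of `L` are chains, and the fibre of `x`
meets every layer `∑ i, x i = r` with `a x ≤ r ≤ n * (m + 1) - a x`. -/
theorem exists_symmetric_chain_labelling (m n : ℕ) :
    ∃ (L : (Fin n → ℕ) → List ℕ) (a : (Fin n → ℕ) → ℕ),
      (∀ x ∈ gridBox m n, ∀ y ∈ gridBox m n, L x = L y → a x = a y ∧ (x ≤ y ∨ y ≤ x)) ∧
      (∀ x ∈ gridBox m n, a x ≤ ∑ i, x i ∧ (∑ i, x i) + a x ≤ n * (m + 1)) ∧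
      (∀ x ∈ gridBox m n, ∀ r, a x ≤ r → r + a x ≤ n * (m + 1) →
        ∃ y ∈ gridBox m n, L y = L x ∧ ∑ i, y i = r) := by
  induction n with
  | zero =>
    refine ⟨fun _ => [], fun _ => 0, fun x _ y _ _ => ⟨rfl, Or.inl fun i => i.elim0⟩,
      fun x _ => by simp, fun x hx r _ hr => ⟨x, hx, rfl, ?_⟩⟩
    simp only [zero_mul] at hr
    simp only [Finset.univ_eq_empty, Finset.sum_empty]
    omega
  | succ n ih =>
    obtain ⟨L, a, hchain, hrange, hsurj⟩ := ih
    have htail : ∀ x ∈ gridBox m (n + 1), Fin.tail x ∈ gridBox m n := fun x hx =>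
      mem_gridBox.2 fun i => mem_gridBox.1 hx i.succ
    have hcons : ∀ t z, 1 ≤ t → t ≤ m → z ∈ gridBox m n →
        (Fin.cons t z : Fin (n + 1) → ℕ) ∈ gridBox m (n + 1) := fun t z h1 h2 hz =>
      mem_gridBox.2 fun i => by
        refine Fin.cases ?_ (fun j => ?_) i
        · exact ⟨h1, h2⟩
        · exact mem_gridBox.1 hz j
    have hsum : ∀ x : Fin (n + 1) → ℕ, ∑ i, x i = x 0 + ∑ i, Fin.tail x i := fun x =>
      Fin.sum_univ_succ x
    -- `[m]` times a chain is a rectangle, cut into nested hooks; `h` is the index of the hook.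
    let h : (Fin (n + 1) → ℕ) → ℕ := fun x =>
      min ((∑ i, Fin.tail x i) - a (Fin.tail x)) (m - x 0)
    have hle : ∀ x y : Fin (n + 1) → ℕ, x ≤ y ↔ x 0 ≤ y 0 ∧ Fin.tail x ≤ Fin.tail y := fun x y =>
      ⟨fun H => ⟨H 0, fun i => H i.succ⟩, fun H i => Fin.cases H.1 (fun j => H.2 j) i⟩
    refine ⟨fun x => h x :: L (Fin.tail x), fun x => a (Fin.tail x) + h x + 1, ?_, ?_, ?_⟩
    · have key : ∀ x ∈ gridBox m (n + 1), ∀ y ∈ gridBox m (n + 1), h x = h y →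
          a (Fin.tail x) = a (Fin.tail y) → Fin.tail x ≤ Fin.tail y → x ≤ y ∨ y ≤ x := by
        intro x hx y hy hh haa hxy
        have hs : ∑ i, Fin.tail x i ≤ ∑ i, Fin.tail y i := Finset.sum_le_sum fun i _ => hxy i
        have hrx := hrange _ (htail x hx)
        have hry := hrange _ (htail y hy)
        have hx0 := mem_gridBox.1 hx 0
        have hy0 := mem_gridBox.1 hy 0
        by_cases h0 : x 0 ≤ y 0
        · exact Or.inl ((hle x y).2 ⟨h0, hxy⟩)
        · right
          -- If both arguments of the minimum were strictly larger at `y`, so would be `h`.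
          have hse : ∑ i, Fin.tail x i = ∑ i, Fin.tail y i := by
            simp only [h] at hh
            omega
          have := (Finset.sum_eq_sum_iff_of_le fun i _ => hxy i).1 hse
          exact (hle y x).2 ⟨by omega, fun i => (this i (Finset.mem_univ i)).ge⟩
      intro x hx y hy hxy
      obtain ⟨hh, hL⟩ := List.cons.inj hxy
      obtain ⟨haa, hc⟩ := hchain _ (htail x hx) _ (htail y hy) hL
      refine ⟨by change a _ + h x + 1 = a _ + h y + 1; rw [hh, haa], ?_⟩
      rcases hc with hc | hc
      · exact key x hx y hy hh haa hc
      · exact (key y hy x hx hh.symm haa.symm hc).symm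
    · intro x hx
      have hrx := hrange _ (htail x hx)
      have hx0 := mem_gridBox.1 hx 0
      rw [hsum x, Nat.succ_mul]
      simp only [h]
      omega
    · intro x hx r h1 h2
      have hrx := hrange _ (htail x hx)
      have hx0 := mem_gridBox.1 hx 0
      have hh1 : h x ≤ (∑ i, Fin.tail x i) - a (Fin.tail x) := min_le_left _ _
      have hh2 : h x ≤ m - x 0 := min_le_right _ _
      rw [Nat.succ_mul] at h2
      change a (Fin.tail x) + h x + 1 ≤ r at h1
      change r + (a (Fin.tail x) + h x + 1) ≤ n * (m + 1) + (m + 1) at h2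
      have main : ∀ t q, 1 ≤ t → t + h x ≤ m → a (Fin.tail x) + h x ≤ q →
          q + a (Fin.tail x) ≤ n * (m + 1) → t + q = r →
          (q = a (Fin.tail x) + h x ∨ t + h x = m) →
          ∃ y ∈ gridBox m (n + 1), h y :: L (Fin.tail y) = h x :: L (Fin.tail x) ∧
            ∑ i, y i = r := by
        intro t q ht htm hq hqn hr hor
        obtain ⟨z, hz, hzL, hzq⟩ := hsurj _ (htail x hx) q (by omega) hqn
        have hza := (hchain _ hz _ (htail x hx) hzL).1
        refine ⟨Fin.cons t z, hcons t z ht (by omega) hz, ?_, ?_⟩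
        · have : h (Fin.cons t z) = h x := by
            change min ((∑ i, z i) - a z) (m - t) = h x
            omega
          rw [this, Fin.tail_cons, hzL]
        · rw [hsum, Fin.tail_cons, Fin.cons_zero, hzq, hr]
      -- The corner of the hook has rank `a (Fin.tail x) + m`: below it the first coordinate varies,
      -- above it the tail.
      by_cases hr : r ≤ a (Fin.tail x) + m
      · exact main (r - (a (Fin.tail x) + h x)) (a (Fin.tail x) + h x) (by omega) (by omega)
          le_rfl (by omega) (by omega) (Or.inl rfl)
      · exact main (m - h x) (r - (m - h x)) (by omega) (by omega) (by omega) (by omega)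
          (by omega) (Or.inr (by omega))

/-- The layer of `[m]^n` on which the coordinates sum to `r`. -/
def gridLayer (m n r : ℕ) : Finset (Fin n → ℕ) :=
  (gridBox m n).filter fun x => ∑ i, x i = r

theorem card_le_card_middle_layer {m n : ℕ} {A : Finset (Fin n → ℕ)} (hA : A ⊆ gridBox m n)
    (hanti : IsAntichain (· ≤ ·) (A : Set (Fin n → ℕ))) :
    A.card ≤ (gridLayer m n (n * (m + 1) / 2)).card := by
  obtain ⟨L, a, hchain, hrange, hsurj⟩ := exists_symmetric_chain_labelling m n
  have hex : ∀ x ∈ A, ∃ y ∈ gridLayer m n (n * (m + 1) / 2), L y = L x := by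
    intro x hx
    have hr := hrange x (hA hx)
    obtain ⟨y, hy, hyL, hys⟩ := hsurj x (hA hx) (n * (m + 1) / 2) (by omega) (by omega)
    exact ⟨y, Finset.mem_filter.2 ⟨hy, hys⟩, hyL⟩
  choose! φ hφ hφL using hex
  refine Finset.card_le_card_of_injOn φ (fun x hx => hφ x hx) fun x hx y hy hxy => ?_
  have hL : L x = L y := by rw [← hφL x hx, ← hφL y hy, hxy]
  rcases (hchain x (hA hx) y (hA hy) hL).2 with h | h
  · exact hanti.eq hx hy h
  · exact (hanti.eq hy hx h).symm

theorem isAntichain_gridLayer (m n r : ℕ) :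
    IsAntichain (· ≤ ·) (gridLayer m n r : Set (Fin n → ℕ)) := by
  intro x hx y hy hne hle
  have hx' := (Finset.mem_filter.1 hx).2
  have hy' := (Finset.mem_filter.1 hy).2
  have := (Finset.sum_eq_sum_iff_of_le fun i _ => hle i).1 (hx'.trans hy'.symm)
  exact hne (funext fun i => this i (Finset.mem_univ i))

theorem maxAntichainSize_eq_card_middle_layer (m n : ℕ) :
    maxAntichainSize m n = (gridLayer m n (n * (m + 1) / 2)).card := by
  classical
  unfold maxAntichainSize
  apply le_antisymm
  · refine Finset.sup_le fun A hA => ?_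
    rw [Finset.mem_filter, Finset.mem_powerset] at hA
    exact card_le_card_middle_layer hA.1 hA.2
  · refine Finset.le_sup (f := Finset.card) ?_
    rw [Finset.mem_filter, Finset.mem_powerset]
    exact ⟨Finset.filter_subset _ _, isAntichain_gridLayer _ _ _⟩

/-! ### Counting a layer by generating functions. -/

open PowerSeries in
theorem coeff_sum_X_pow_pow (m n r : ℕ) :
    coeff r ((∑ j ∈ Finset.Icc 1 m, (X : ℤ⟦X⟧) ^ j) ^ n) = (gridLayer m n r).card := by
  have h : (∑ j ∈ Finset.Icc 1 m, (X : ℤ⟦X⟧) ^ j) ^ n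
      = ∑ x ∈ gridBox m n, (X : ℤ⟦X⟧) ^ ∑ i, x i := by
    have := Finset.prod_univ_sum (fun _ : Fin n => Finset.Icc 1 m)
      (fun _ j => (X : ℤ⟦X⟧) ^ j)
    rw [Finset.prod_const, Finset.card_univ, Fintype.card_fin] at this
    rw [this]
    exact Finset.sum_congr rfl fun x _ => Finset.prod_pow_eq_pow_sum _ _ _
  rw [h, map_sum, gridLayer, Finset.card_filter]
  push_cast
  refine Finset.sum_congr rfl fun x _ => ?_
  rw [coeff_X_pow]
  simp only [eq_comm]

open PowerSeries in
theorem sum_X_pow_pow_eq (m k : ℕ) :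
    (∑ j ∈ Finset.Icc 1 m, (X : ℤ⟦X⟧) ^ j) ^ (k + 1)
      = X ^ (k + 1) * ((1 - X ^ m) ^ (k + 1) * mk fun s => ((k + s).choose k : ℤ)) := by
  rw [← mk_one_pow_eq_mk_choose_add, ← mul_pow, ← mul_pow]
  congr 1
  have h1 : ∑ j ∈ Finset.Icc 1 m, (X : ℤ⟦X⟧) ^ j = X * ∑ j ∈ Finset.range m, X ^ j := by
    rw [← Finset.Ico_add_one_right_eq_Icc, Finset.sum_Ico_eq_sum_range, Finset.mul_sum]
    exact Finset.sum_congr rfl fun j _ => by rw [pow_add, pow_one]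
  rw [h1, ← geom_sum_mul_neg, mul_assoc, mul_comm (1 - X), mk_one_mul_one_sub_eq_one, mul_one]

open PowerSeries in
theorem card_gridLayer (m k s : ℕ) :
    ((gridLayer m (k + 1) (s + (k + 1))).card : ℤ) = ∑ i ∈ Finset.range (k + 2),
      (-1) ^ i * ((k + 1).choose i : ℤ) *
        if m * i ≤ s then ((k + (s - m * i)).choose k : ℤ) else 0 := by
  rw [← coeff_sum_X_pow_pow, sum_X_pow_pow_eq, coeff_X_pow_mul, sub_eq_neg_add, add_pow,
    Finset.sum_mul, map_sum]
  refine Finset.sum_congr rfl fun i _ => ?_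
  have : (-X ^ m : ℤ⟦X⟧) ^ i * 1 ^ (k + 1 - i) * ((k + 1).choose i : ℤ⟦X⟧)
        * mk (fun s => ((k + s).choose k : ℤ))
      = C ((-1) ^ i * ((k + 1).choose i : ℤ)) *
        (X ^ (m * i) * mk (fun s => ((k + s).choose k : ℤ))) := by
    rw [neg_pow, pow_mul]
    simp only [one_pow, map_mul, map_pow, map_neg, map_one, map_natCast]
    ring
  rw [this, coeff_C_mul, coeff_X_pow_mul']
  simp only [coeff_mk]

/-! ### Truncated power sums and the closed form of the density. -/

theorem sum_alternating_choose_mul_sub_pow (k : ℕ) (x : ℝ) :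
    ∑ i ∈ Finset.range (k + 1), (-1) ^ i * (k.choose i : ℝ) * (x - i) ^ k = k.factorial := by
  have h := congrFun (fwdDiff_iter_eq_factorial (R := ℝ) (n := k)) (x - k)
  rw [fwdDiff_iter_eq_sum_shift, ← Finset.sum_range_reflect] at h
  simp only [Pi.natCast_apply] at h
  rw [← h]
  refine Finset.sum_congr rfl fun i hi => ?_
  have hi' : i ≤ k := Nat.lt_succ_iff.1 (Finset.mem_range.1 hi)
  have e1 : k + 1 - 1 - i = k - i := by omega
  rw [e1, Nat.choose_symm hi', Nat.sub_sub_self hi', nsmul_eq_mul, Nat.cast_sub hi', mul_one,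
    zsmul_eq_mul]
  push_cast
  ring

/-- The distribution function of a sum of `k` independent uniform variables on `[0, 1]`, times
`k!`, with the number `N` of contributing terms made explicit. -/
noncomputable def truncatedPowerSum (k N : ℕ) (x : ℝ) : ℝ :=
  ∑ i ∈ Finset.range N, (-1) ^ i * (k.choose i : ℝ) * (x - i) ^ k

/-- The full alternating sum is a `k`-th difference of a `k`-th power, hence `k!`; under `i ↦ k - i`
its terms beyond `N` form the truncated sum at `k - x`. -/
theorem truncatedPowerSum_reflect {k N : ℕ} (hN : N ≤ k + 1) (x : ℝ) :
    truncatedPowerSum k N x + truncatedPowerSum k (k + 1 - N) (k - x) = k.factorial := by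
  rw [← sum_alternating_choose_mul_sub_pow k x, truncatedPowerSum, truncatedPowerSum,
    ← Finset.sum_range_add_sum_Ico _ hN, Finset.sum_Ico_eq_sum_range]
  congr 1
  rw [← Finset.sum_range_reflect]
  refine Finset.sum_congr rfl fun j hj => ?_
  have hj' := Finset.mem_range.1 hj
  obtain ⟨l, hl⟩ : ∃ l, k = l + (k + 1 - N - 1 - j) := ⟨k - (k + 1 - N - 1 - j), by omega⟩
  have e : N + j = l := by omega
  rw [e]
  generalize k + 1 - N - 1 - j = p at hl
  subst hl
  have e2 : ((l + p : ℕ) : ℝ) - x - p = (-1) * (x - l) := by push_cast; ring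
  have e3 : (-1 : ℝ) ^ p * (-1) ^ p = 1 := by rw [← mul_pow]; simp
  rw [e2, mul_pow, pow_add (-1 : ℝ) l p, Nat.choose_symm_add]
  linear_combination (-1 : ℝ) ^ l * ((l + p).choose p : ℝ) * (x - l) ^ (l + p) * e3

theorem sum_alternating_choose_succ (k N : ℕ) (x : ℝ) :
    ∑ i ∈ Finset.range (N + 1), (-1) ^ i * ((k + 1).choose i : ℝ) * (x - i) ^ k
      = truncatedPowerSum k (N + 1) x - truncatedPowerSum k N (x - 1) := by
  rw [truncatedPowerSum, truncatedPowerSum, Finset.sum_range_succ', Finset.sum_range_succ' _ N,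
    add_sub_right_comm, ← Finset.sum_sub_distrib]
  congr 1
  · refine Finset.sum_congr rfl fun i _ => ?_
    rw [Nat.choose_succ_succ]
    push_cast
    ring
  · simp

theorem sum_antichainTerm {k J : ℕ} (hJ : J ≤ k) (a b : ℝ) :
    ∑ i ∈ Finset.range J, antichainTerm (k + 1) a b i
      = (truncatedPowerSum k J b - truncatedPowerSum k J a) / k.factorial := by
  rw [truncatedPowerSum, truncatedPowerSum, ← Finset.sum_sub_distrib, Finset.sum_div]
  refine Finset.sum_congr rfl fun i hi => ?_
  have hi' : i ≤ k := (Finset.mem_range.1 hi).le.trans hJ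
  rw [antichainTerm, Nat.add_sub_cancel, Nat.cast_choose ℝ hi']
  have h1 := Nat.cast_ne_zero (R := ℝ).2 (Nat.factorial_ne_zero k)
  have h2 := Nat.cast_ne_zero (R := ℝ).2 (Nat.factorial_ne_zero i)
  have h3 := Nat.cast_ne_zero (R := ℝ).2 (Nat.factorial_ne_zero (k - i))
  field_simp

theorem truncatedPowerSum_succ_self {k : ℕ} (hk : 1 ≤ k) (N : ℕ) :
    truncatedPowerSum k (N + 1) N = truncatedPowerSum k N N := by
  rw [truncatedPowerSum, Finset.sum_range_succ, sub_self, zero_pow (by omega), mul_zero, add_zero,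
    truncatedPowerSum]

/-- The sum over `j` telescopes, since the term `i = j` vanishes at the lower endpoint `j`. -/
theorem sum_sum_antichainTerm {k : ℕ} (hk : 1 ≤ k) {J : ℕ} (hJ : J ≤ k) :
    ∑ j ∈ Finset.range J, ∑ i ∈ Finset.range (j + 1), antichainTerm (k + 1) j (1 + j) i
      = truncatedPowerSum k J J / k.factorial := by
  have h : ∀ j ∈ Finset.range J,
      ∑ i ∈ Finset.range (j + 1), antichainTerm (k + 1) j (1 + j) i
        = truncatedPowerSum k (j + 1) ((j + 1 : ℕ) : ℝ) / k.factorial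
          - truncatedPowerSum k j j / k.factorial := by
    intro j hj
    have := Finset.mem_range.1 hj
    rw [sum_antichainTerm (by omega), truncatedPowerSum_succ_self hk, sub_div]
    push_cast
    rw [add_comm (1 : ℝ)]
  rw [Finset.sum_congr rfl h, Finset.sum_range_sub (fun j : ℕ =>
    truncatedPowerSum k j (j : ℝ) / k.factorial)]
  simp [truncatedPowerSum]

theorem antichainDensity_succ {k : ℕ} (hk : 1 ≤ k) :
    antichainDensity (k + 1)
      = 1 - 2 * (truncatedPowerSum k (k / 2) (((k : ℝ) - 1) / 2) / k.factorial) := by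
  unfold antichainDensity
  split_ifs with h
  · obtain ⟨q, hq⟩ := h
    obtain ⟨p, rfl⟩ : ∃ p, k = 2 * p + 1 := ⟨q - 1, by omega⟩
    have e1 : (2 * p + 1 + 1 - 2) / 2 = p := by omega
    have e2 : (2 * p + 1) / 2 = p := by omega
    have e3 : (((2 * p + 1 : ℕ) : ℝ) - 1) / 2 = p := by push_cast; ring
    rw [e1, e2, e3, sum_sum_antichainTerm hk (by omega)]
  · obtain ⟨p, rfl⟩ : ∃ p, k = 2 * p + 2 := by
      rw [Nat.not_even_iff] at h
      exact ⟨k / 2 - 1, by omega⟩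
    have e1 : (2 * p + 2 + 1 - 3) / 2 = p := by omega
    have e2 : (2 * p + 2 + 1 - 1) / 2 = p + 1 := by omega
    have e2' : (2 * p + 2) / 2 = p + 1 := by omega
    have e3 : (((2 * p + 2 + 1 : ℕ) : ℝ) - 3) / 2 = p := by push_cast; ring
    have e4 : ((2 * p + 2 + 1 : ℕ) : ℝ) / 2 - 1 = (((2 * p + 2 : ℕ) : ℝ) - 1) / 2 := by
      push_cast; ring
    rw [e1, e2, e2', e3, e4, sum_sum_antichainTerm hk (by omega), sum_antichainTerm (by omega),
      truncatedPowerSum_succ_self hk]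
    ring

/-- Pascal's rule gives a difference of truncated sums at `(k + 1) / 2` and `(k - 1) / 2`, points
exchanged by the reflection. -/
theorem sum_alternating_half {k : ℕ} (hk : 1 ≤ k) :
    ∑ i ∈ Finset.range (k / 2 + 1), (-1) ^ i * ((k + 1).choose i : ℝ) *
        (((k : ℝ) + 1) / 2 - i) ^ k = k.factorial * antichainDensity (k + 1) := by
  have hf := Nat.cast_ne_zero (R := ℝ).2 (Nat.factorial_ne_zero k)
  have hr := truncatedPowerSum_reflect (k := k) (N := k / 2 + 1) (by omega) (((k : ℝ) + 1) / 2)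
  have e1 : (k : ℝ) - (k + 1) / 2 = (k - 1) / 2 := by ring
  have e2 : ((k : ℝ) + 1) / 2 - 1 = (k - 1) / 2 := by ring
  -- For odd `k` the left side has one extra term, zero at the integer `(k - 1) / 2`.
  have e3 : truncatedPowerSum k (k + 1 - (k / 2 + 1)) (((k : ℝ) - 1) / 2)
      = truncatedPowerSum k (k / 2) (((k : ℝ) - 1) / 2) := by
    rcases Nat.even_or_odd' k with ⟨q, rfl | rfl⟩
    · congr 1; omega
    · have a1 : 2 * q + 1 + 1 - ((2 * q + 1) / 2 + 1) = q + 1 := by omega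
      have a2 : (2 * q + 1) / 2 = q := by omega
      have a3 : (((2 * q + 1 : ℕ) : ℝ) - 1) / 2 = q := by push_cast; ring
      rw [a1, a2, a3, truncatedPowerSum_succ_self hk]
  rw [e1, e3] at hr
  rw [sum_alternating_choose_succ, e2, antichainDensity_succ hk]
  field_simp
  linarith

/-! ### Asymptotics as `m → ∞`. -/

theorem isBigO_ascFactorial_sub (t : ℕ → ℕ) (c : ℝ)
    (ht : (fun m : ℕ => (t m : ℝ) - c * m) =O[atTop] fun _ => (1 : ℝ)) (k : ℕ) :
    (fun m : ℕ => ((t m + 1).ascFactorial (k + 1) : ℝ) - (c * m) ^ (k + 1))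
      =O[atTop] fun m : ℕ => (m : ℝ) ^ k := by
  have hc : ∀ d : ℝ, (fun _ : ℕ => d) =O[atTop] fun _ : ℕ => (1 : ℝ) := fun d =>
    isBigO_const_const d one_ne_zero _
  have hshift : ∀ d : ℝ, (fun m : ℕ => (t m : ℝ) + d - c * m) =O[atTop] fun _ => (1 : ℝ) :=
    fun d => (ht.add (hc d)).congr_left fun m => by ring
  have hcm : (fun m : ℕ => c * (m : ℝ)) =O[atTop] fun m : ℕ => (m : ℝ) :=
    isBigO_const_mul_self _ _ _
  have hone : (fun _ : ℕ => (1 : ℝ)) =O[atTop] fun m : ℕ => (m : ℝ) := by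
    refine IsBigO.of_bound 1 ?_
    filter_upwards [eventually_ge_atTop 1] with m hm
    have : (1 : ℝ) ≤ m := by exact_mod_cast hm
    simpa using this
  induction k with
  | zero =>
    refine (hshift 1).congr (fun m => ?_) fun m => (pow_zero _).symm
    simp [Nat.ascFactorial]
  | succ k ih =>
    have h1 : (fun m : ℕ => (t m : ℝ) + (k + 2)) =O[atTop] fun m : ℕ => (m : ℝ) :=
      (((hshift (k + 2)).trans hone).add hcm).congr_left fun m => by ring
    have h2 := (ih.mul h1).add (((hcm.pow (k + 1)).mul (hshift (k + 2))).trans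
      (isBigO_of_le _ (g := fun m : ℕ => (m : ℝ) ^ k * (m : ℝ)) fun m => by
        rw [mul_one, pow_succ]))
    refine h2.congr (fun m => ?_) fun m => (pow_succ _ _).symm
    rw [Nat.ascFactorial_succ (k := k + 1)]
    push_cast
    ring

theorem isBigO_choose_sub (t : ℕ → ℕ) (c : ℝ)
    (ht : (fun m : ℕ => (t m : ℝ) - c * m) =O[atTop] fun _ => (1 : ℝ)) {k : ℕ} (hk : 1 ≤ k) :
    (fun m : ℕ => ((k + t m).choose k : ℝ) - c ^ k * (m : ℝ) ^ k / k.factorial)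
      =O[atTop] fun m : ℕ => (m : ℝ) ^ (k - 1) := by
  obtain ⟨k, rfl⟩ : ∃ l, k = l + 1 := ⟨k - 1, by omega⟩
  refine ((isBigO_ascFactorial_sub t c ht k).const_mul_left
    (((k + 1).factorial : ℝ)⁻¹)).congr_left fun m => ?_
  have hf := Nat.cast_ne_zero (R := ℝ).2 (Nat.factorial_ne_zero (k + 1))
  rw [Nat.ascFactorial_eq_factorial_mul_choose, add_comm (k + 1)]
  push_cast [mul_pow]
  field_simp

/-- For large `m`, the cutoff `m * i ≤ (k + 1) * (m - 1) / 2` becomes `2 * i ≤ k`, independent of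
`m`. -/
theorem card_middle_layer {m k : ℕ} (hm : k + 2 ≤ m) :
    ((gridLayer m (k + 1) ((k + 1) * (m + 1) / 2)).card : ℝ)
      = ∑ i ∈ Finset.range (k / 2 + 1), (-1) ^ i * ((k + 1).choose i : ℝ) *
        ((k + ((k + 1) * (m - 1) / 2 - m * i)).choose k : ℝ) := by
  have hs : (k + 1) * (m + 1) / 2 = (k + 1) * (m - 1) / 2 + (k + 1) := by
    obtain ⟨m, rfl⟩ : ∃ l, m = l + 1 := ⟨m - 1, by omega⟩
    rw [show (k + 1) * (m + 1 + 1) = (k + 1) * m + 2 * (k + 1) by ring, Nat.add_sub_cancel]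
    omega
  have h := congrArg (Int.cast : ℤ → ℝ) (card_gridLayer m k ((k + 1) * (m - 1) / 2))
  rw [hs]
  push_cast at h
  rw [h, ← Finset.sum_range_add_sum_Ico _ (show k / 2 + 1 ≤ k + 2 by omega)]
  rw [Finset.sum_eq_zero (s := Finset.Ico _ _), add_zero]
  · refine Finset.sum_congr rfl fun i hi => ?_
    rw [if_pos]
    have hi' : 2 * i ≤ k := by have := Finset.mem_range.1 hi; omega
    obtain ⟨l, rfl⟩ : ∃ l, m = l + 1 := ⟨m - 1, by omega⟩
    rw [Nat.le_div_iff_mul_le two_pos, Nat.add_sub_cancel]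
    nlinarith
  · intro i hi
    rw [if_neg, mul_zero]
    have hi' : k + 1 ≤ 2 * i := by have := Finset.mem_Ico.1 hi; omega
    obtain ⟨l, rfl⟩ : ∃ l, m = l + 1 := ⟨m - 1, by omega⟩
    rw [not_le, Nat.div_lt_iff_lt_mul two_pos, Nat.add_sub_cancel]
    nlinarith

theorem isBigO_half_sub {k i : ℕ} (hi : 2 * i ≤ k) :
    (fun m : ℕ => (((k + 1) * (m - 1) / 2 - m * i : ℕ) : ℝ) - (((k : ℝ) + 1) / 2 - i) * m)
      =O[atTop] fun _ => (1 : ℝ) := by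
  -- The error is exactly `-(k + 1 + d) / 2`, with `d ≤ 1` the remainder of the halving.
  refine IsBigO.of_bound ((k : ℝ) + 2) ?_
  filter_upwards [eventually_ge_atTop (k + 2)] with m hm
  obtain ⟨l, rfl⟩ : ∃ l, m = l + 1 := ⟨m - 1, by omega⟩
  rw [Nat.add_sub_cancel]
  have hle : (l + 1) * i ≤ (k + 1) * l / 2 := by
    rw [Nat.le_div_iff_mul_le two_pos]
    nlinarith
  obtain ⟨d, hd1, hd2⟩ : ∃ d : ℕ, d ≤ 1 ∧ (k + 1) * l = 2 * ((k + 1) * l / 2) + d :=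
    ⟨(k + 1) * l % 2, by omega, by omega⟩
  rw [Nat.cast_sub hle]
  have hd2' := congrArg (Nat.cast : ℕ → ℝ) hd2
  have hd1' : (d : ℝ) ≤ 1 := by exact_mod_cast hd1
  have hd0 : (0 : ℝ) ≤ d := Nat.cast_nonneg d
  have hk0 : (0 : ℝ) ≤ k := Nat.cast_nonneg k
  generalize (k + 1) * l / 2 = s at *
  push_cast at hd2' ⊢
  rw [norm_one, mul_one, Real.norm_eq_abs, abs_le]
  constructor <;> nlinarith

theorem theorem3 (n : ℕ) (hn : 2 ≤ n) :
    (fun m : ℕ => (maxAntichainSize m n : ℝ) - (m : ℝ) ^ (n - 1) * antichainDensity n)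
      =O[atTop] fun m : ℕ => (m : ℝ) ^ (n - 2) := by
  obtain ⟨k, rfl⟩ : ∃ k, n = k + 1 := ⟨n - 1, by omega⟩
  have hk : 1 ≤ k := by omega
  have e : k + 1 - 2 = k - 1 := by omega
  rw [e, Nat.add_sub_cancel]
  have hsum : (fun m : ℕ => ∑ i ∈ Finset.range (k / 2 + 1), (-1) ^ i * ((k + 1).choose i : ℝ) *
      (((k + ((k + 1) * (m - 1) / 2 - m * i)).choose k : ℝ)
        - (((k : ℝ) + 1) / 2 - i) ^ k * (m : ℝ) ^ k / k.factorial))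
      =O[atTop] fun m : ℕ => (m : ℝ) ^ (k - 1) := by
    refine IsBigO.fun_sum fun i hi => ?_
    have hi' : 2 * i ≤ k := by have := Finset.mem_range.1 hi; omega
    exact (isBigO_choose_sub _ _ (isBigO_half_sub hi') hk).const_mul_left _
  refine hsum.congr' ?_ EventuallyEq.rfl
  filter_upwards [eventually_ge_atTop (k + 2)] with m hm
  have hf := Nat.cast_ne_zero (R := ℝ).2 (Nat.factorial_ne_zero k)
  have hmain : (m : ℝ) ^ k * antichainDensity (k + 1) = ∑ i ∈ Finset.range (k / 2 + 1),
      (-1) ^ i * ((k + 1).choose i : ℝ) *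
        ((((k : ℝ) + 1) / 2 - i) ^ k * (m : ℝ) ^ k / k.factorial) := by
    rw [eq_comm, ← mul_right_inj' hf, mul_left_comm, ← sum_alternating_half hk, Finset.mul_sum,
      Finset.mul_sum]
    refine Finset.sum_congr rfl fun i _ => ?_
    field_simp
  rw [maxAntichainSize_eq_card_middle_layer, card_middle_layer hm, hmain,
    ← Finset.sum_sub_distrib]
  exact Finset.sum_congr rfl fun i _ => mul_sub _ _ _
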